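/- Let $\mathbb{K}$ be a field of characteristic $0$ and let $\mathcal{W}$ be the Witt algebra over $\mathbb{K}$, i.e. the Lie algebra with vector space basis $\{e_n : n\in\mathbb{Z}\}$ and bracket $[e_n,e_m]=(m-n)e_{n+m}$. For $q\ge 0$ let $C^q(\mathcal{W},\mathcal{W})$ be the space of all alternating $\mathbb{K}$-multilinear maps $\mathcal{W}^q\to\mathcal{W}$ (no continuity is assumed), and let $\delta_q:C^q(\mathcal{W},\mathcal{W})\to C^{q+1}(\mathcal{W},\mathcal{W})$ be the Chevalley–Eilenberg coboundary operator for the adjoint module, $$(\delta_q\psi)(x_1,\dots,x_{q+1})=\sum_{1\le i<j\le q+1}(-1)^{i+j+1}\,\psi([x_i,x_j],x_1,\dots,\hat{x}_i,\dots,\hat{x}_j,\dots,x_{q+1})+\sum_{i=1}^{q+1}(-1)^i\,[x_i,\psi(x_1,\dots,\hat{x}_i,\dots,x_{q+1})],$$ where $\hat{x}_i$ means that the entry $x_i$ is omitted. Then the third algebraic Chevalley–Eilenberg cohomology of $\mathcal{W}$ with values in the adjoint module vanishes: $$\mathrm{H}^3(\mathcal{W},\mathcal{W})=\ker\delta_3/\operatorname{im}\delta_2=\{0\}.$$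 -/

import Mathlib

/-! ### The Chevalley–Eilenberg complex of a Lie algebra with values in a module -/

namespace ChevalleyEilenberg

variable (K L M : Type*) [Field K] [LieRing L] [LieAlgebra K L]
  [AddCommGroup M] [Module K M]

/-- The space of `q`-cochains: alternating `K`-multilinear maps of `q` arguments in `L` with values
in `M` (no continuity or finiteness condition). -/
abbrev Cochain (q : ℕ) := L [⋀^Fin q]→ₗ[K] M

variable {K L M}

/-- The part of the coboundary operator that involves the bracket of `L`,
`∑_{a < b} (-1)^(a+b+1) ψ([x_a, x_b], x_1, …, x̂_a, …, x̂_b, …, x_{n+2})`, where the arguments are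
numbered from `1`. The pairs `a < b` are encoded by `i ≤ j` in `Fin (n + 1)`: the entry `x_a` is
`x i.castSucc` (so `a = i + 1`) and `x_b` is `x j.succ` (so `b = j + 2`), whence the sign is
`(-1)^(i+j)`. Once `x_a` is removed, `x_b` stands at place `j`. For `q = 0` the sum is empty. -/
def bracketSum : {q : ℕ} → Cochain K L M q → (Fin (q + 1) → L) → M
  | 0, _, _ => 0
  | n + 1, ψ, x => ∑ i : Fin (n + 1), ∑ j ≥ i, (-1 : ℤ) ^ (i + j : ℕ) •
      ψ (Fin.cons ⁅x i.castSucc, x j.succ⁆ (j.removeNth (i.castSucc.removeNth x)))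

/-- Auxiliary: an alternating map with the values of `bracketSum`. -/
noncomputable def bracketAux : {q : ℕ} → Cochain K L M q → Cochain K L M (q + 1)
  | 0, _ => 0
  | _ + 1, ψ => (2 : K)⁻¹ • AlternatingMap.alternatizeUncurryFin
      (AlternatingMap.alternatizeUncurryFinLM ∘ₗ
        ((LieModule.toEnd K L L : L →ₗ[K] L →ₗ[K] L).compr₂ ψ.curryLeft))

theorem bracketAux_apply [CharZero K] {q : ℕ} (ψ : Cochain K L M q) (x : Fin (q + 1) → L) :
    bracketAux ψ x = bracketSum ψ x := by
  cases q with
  | zero => rfl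
  | succ n =>
    rw [bracketAux, AlternatingMap.smul_apply,
      AlternatingMap.alternatizeUncurryFin_alternatizeUncurryFinLM_comp_apply, bracketSum,
      inv_smul_eq_iff₀ two_ne_zero]
    simp only [Finset.smul_sum]
    refine Finset.sum_congr rfl fun i _ => Finset.sum_congr rfl fun j _ => ?_
    rw [smul_comm, two_smul]
    congr 1
    simp only [LinearMap.compr₂_apply, LieHom.coe_toLinearMap, LieModule.toEnd_apply_apply]
    have h : ψ.curryLeft ⁅x j.succ, x i.castSucc⁆ = -ψ.curryLeft ⁅x i.castSucc, x j.succ⁆ := by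
      rw [← lie_skew, map_neg]
    rw [h, AlternatingMap.neg_apply, sub_neg_eq_add]
    rfl

variable [LieRingModule L M]

/-- The part of the coboundary operator that involves the action of `L` on `M`,
`∑_a (-1)^a x_a · ψ(x_1, …, x̂_a, …, x_{q+1})`, where the arguments are numbered from `1`
(so `a = i + 1`). -/
def actionSum {q : ℕ} (ψ : Cochain K L M q) (x : Fin (q + 1) → L) : M :=
  ∑ i : Fin (q + 1), (-1 : ℤ) ^ ((i : ℕ) + 1) • ⁅x i, ψ (i.removeNth x)⁆

variable [LieModule K L M]

/-- Auxiliary: an alternating map with the values of `actionSum`. -/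
noncomputable def actionAux {q : ℕ} (ψ : Cochain K L M q) : Cochain K L M (q + 1) :=
  -AlternatingMap.alternatizeUncurryFin
    { toFun := fun x => (LieModule.toEnd K L M x).compAlternatingMap ψ
      map_add' := fun x y => by ext; simp
      map_smul' := fun c x => by ext; simp }

theorem actionAux_apply {q : ℕ} (ψ : Cochain K L M q) (x : Fin (q + 1) → L) :
    actionAux ψ x = actionSum ψ x := by
  simp [actionAux, actionSum, AlternatingMap.alternatizeUncurryFin_apply, pow_succ]

variable [CharZero K]

/-- The Chevalley–Eilenberg coboundary operator `δ_q : C^q(L, M) → C^{q+1}(L, M)`. -/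
noncomputable def coboundary (q : ℕ) : Cochain K L M q →ₗ[K] Cochain K L M (q + 1) where
  toFun ψ :=
    { toFun := fun x => bracketSum ψ x + actionSum ψ x
      map_update_add' := fun x i a b => by
        simp only [← bracketAux_apply, ← actionAux_apply, AlternatingMap.map_update_add]
        abel
      map_update_smul' := fun x i c a => by
        simp only [← bracketAux_apply, ← actionAux_apply, AlternatingMap.map_update_smul, smul_add]
      map_eq_zero_of_eq' := fun x i j h hij => by
        simp only [← bracketAux_apply, ← actionAux_apply]
        rw [(bracketAux ψ).map_eq_zero_of_eq x h hij, (actionAux ψ).map_eq_zero_of_eq x h hij,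
          add_zero] }
  map_add' ψ φ := by
    ext x
    cases q with
    | zero => simp [bracketSum, actionSum]
    | succ n =>
      simp only [bracketSum, actionSum, AlternatingMap.coe_mk, AlternatingMap.add_apply,
        MultilinearMap.coe_mk, smul_add, lie_add, Finset.sum_add_distrib]
      abel
  map_smul' c ψ := by
    ext x
    cases q <;> simp [bracketSum, actionSum, Finset.smul_sum, smul_comm _ c]

theorem coboundary_apply {q : ℕ} (ψ : Cochain K L M q) (x : Fin (q + 1) → L) :
    coboundary q ψ x = bracketSum ψ x + actionSum ψ x := rfl

set_option linter.unusedSectionVars false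

/-! #### The operator `δ` squares to zero (through the Lie derivative of cochains) -/

/-- The value of the Lie derivative of a cochain. -/
def lieDer {q : ℕ} (x : L) (ψ : Cochain K L M q) (v : Fin q → L) : M :=
  ⁅x, ψ v⁆ - ∑ j : Fin q, ψ (Function.update v j ⁅x, v j⁆)

theorem coboundary_cons_zero (ψ : Cochain K L M 0) (x : L) (v : Fin 0 → L) :
    coboundary 0 ψ (Fin.cons x v) = -⁅x, ψ v⁆ := by
  rw [coboundary_apply, bracketSum, actionSum]
  simp

theorem coboundary_cons {n : ℕ} (ψ : Cochain K L M (n+1)) (x : L) (v : Fin (n+1) → L) :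
    coboundary (n+1) ψ (Fin.cons x v) = - lieDer x ψ v - coboundary n (ψ.curryLeft x) v := by
  rw [coboundary_apply, coboundary_apply, lieDer, actionSum, Fin.sum_univ_succ, bracketSum,
    Fin.sum_univ_succ]
  have hA : ∑ i : Fin (n+1), (-1 : ℤ) ^ ((i.succ : ℕ) + 1) •
      ⁅(Fin.cons x v : Fin (n+2) → L) i.succ, ψ (i.succ.removeNth (Fin.cons x v : Fin (n+2) → L))⁆
      = - actionSum (ψ.curryLeft x) v := by
    rw [actionSum, ← Finset.sum_neg_distrib]
    refine Finset.sum_congr rfl fun i _ => ?_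
    have : i.succ.removeNth (Fin.cons x v : Fin (n+2) → L) = Fin.cons x (i.removeNth v) := by
      ext k; refine Fin.cases ?_ (fun k => ?_) k <;> simp [Fin.removeNth]
    rw [this, Fin.cons_succ, Fin.val_succ, pow_succ]
    simp only [mul_neg, mul_one, neg_smul]
    rfl
  rw [hA]
  have hB : ∑ i : Fin n, ∑ j ≥ i.succ, (-1 : ℤ) ^ ((i.succ : ℕ) + (j : ℕ)) •
      ψ (Fin.cons ⁅(Fin.cons x v : Fin (n+2) → L) i.succ.castSucc, (Fin.cons x v : Fin (n+2) → L) j.succ⁆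
        (j.removeNth (i.succ.castSucc.removeNth (Fin.cons x v : Fin (n+2) → L))))
      = - bracketSum (ψ.curryLeft x) v := by
    cases n with
    | zero => simp [bracketSum]
    | succ n =>
      rw [bracketSum, ← Finset.sum_neg_distrib]
      refine Finset.sum_congr rfl fun i _ => ?_
      rw [← Finset.sum_neg_distrib, ← Fin.map_succEmb_Ici, Finset.sum_map]
      refine Finset.sum_congr rfl fun j _ => ?_
      have : (Fin.succEmb _ j).removeNth (i.succ.castSucc.removeNth (Fin.cons x v : Fin (n+3) → L))
         = Fin.cons x (j.removeNth (i.castSucc.removeNth v)) := by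
        ext k; refine Fin.cases ?_ (fun k => ?_) k <;> simp [Fin.removeNth]
      rw [this]
      have hs := ψ.map_swap (Fin.cons ⁅v i.castSucc, v j.succ⁆ (Fin.cons x (j.removeNth (i.castSucc.removeNth v)))) (i := 0) (j := 1) (by simp)
      have h2 : (Fin.cons ⁅v i.castSucc, v j.succ⁆ (Fin.cons x (j.removeNth (i.castSucc.removeNth v))) : Fin (n+2) → L) ∘ Equiv.swap 0 1
         = Fin.cons x (Fin.cons ⁅v i.castSucc, v j.succ⁆ (j.removeNth (i.castSucc.removeNth v))) := by
        ext k; refine Fin.cases ?_ (fun k => Fin.cases ?_ (fun k => ?_) k) k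
        · simp
        · rw [Function.comp_apply, show Fin.succ (0 : Fin (n+1)) = 1 from rfl, Equiv.swap_apply_right]
          rfl
        · rw [Function.comp_apply, Equiv.swap_apply_of_ne_of_ne (by simp) (by simp [Fin.ext_iff])]
          rfl
      rw [h2] at hs
      simp only [← Fin.succ_castSucc, Fin.cons_succ, Fin.coe_succEmb, Fin.val_succ]
      rw [show (-1:ℤ)^((i:ℕ)+1+((j:ℕ)+1)) = (-1)^((i:ℕ)+(j:ℕ)) by ring, ← smul_neg]
      congr 1
      rw [eq_neg_iff_add_eq_zero, ← neg_eq_iff_add_eq_zero]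
      exact hs.symm
  rw [hB]
  have hC : Finset.Ici (0 : Fin (n+1)) = Finset.univ := by ext; simp
  have hD : ∀ j : Fin (n+1), (-1 : ℤ) ^ (j : ℕ) • ψ (Fin.cons ⁅x, v j⁆ (j.removeNth v)) = ψ (Function.update v j ⁅x, v j⁆) := by
    intro j
    rw [← Fin.insertNth_removeNth, AlternatingMap.map_insertNth]
    rcases Nat.even_or_odd (j : ℕ) with h | h <;> simp [h.neg_one_pow] <;> rfl
  rw [hC]
  simp [Fin.removeNth_zero, hD]
  abel

theorem lieDer_cons {n : ℕ} (x y : L) (ψ : Cochain K L M (n+1)) (v : Fin n → L) :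
    lieDer x ψ (Fin.cons y v) = lieDer x (ψ.curryLeft y) v - ψ (Fin.cons ⁅x, y⁆ v) := by
  simp only [lieDer, Fin.sum_univ_succ, Fin.cons_zero, Fin.cons_succ, Fin.update_cons_zero,
    ← Fin.cons_update]
  rw [← sub_sub, sub_right_comm]
  rfl

/-- The Lie derivative of cochains, as a linear map. -/
noncomputable def theta (x : L) : (q : ℕ) → Cochain K L M q →ₗ[K] Cochain K L M q
  | 0 => -((AlternatingMap.curryLeftLinearMap.flip x) ∘ₗ coboundary 0)
  | q + 1 => -((AlternatingMap.curryLeftLinearMap.flip x) ∘ₗ coboundary (q + 1)) -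
      coboundary q ∘ₗ (AlternatingMap.curryLeftLinearMap.flip x)

theorem theta_apply {q : ℕ} (x : L) (ψ : Cochain K L M q) (v : Fin q → L) :
    theta x q ψ v = lieDer x ψ v := by
  cases q with
  | zero =>
    change -coboundary 0 ψ (Fin.cons x v) = _
    simp [coboundary_cons_zero, lieDer]
  | succ q =>
    change -coboundary (q + 1) ψ (Fin.cons x v) - coboundary q (ψ.curryLeft x) v = _
    rw [coboundary_cons]
    abel

theorem curryLeft_theta {q : ℕ} (x y : L) (ψ : Cochain K L M (q + 1)) :
    (theta x (q + 1) ψ).curryLeft y = theta x q (ψ.curryLeft y) - ψ.curryLeft ⁅x, y⁆ := by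
  ext v
  rw [AlternatingMap.sub_apply, theta_apply]
  exact (theta_apply x ψ (Fin.cons y v)).trans (lieDer_cons x y ψ v)

theorem curryLeft_coboundary {q : ℕ} (x : L) (ψ : Cochain K L M (q + 1)) :
    (coboundary (q + 1) ψ).curryLeft x = -theta x (q + 1) ψ - coboundary q (ψ.curryLeft x) := by
  ext v
  rw [AlternatingMap.sub_apply, AlternatingMap.neg_apply, theta_apply, ← coboundary_cons ψ x v]
  rfl

theorem curryLeft_coboundary_zero (x : L) (ψ : Cochain K L M 0) :
    (coboundary 0 ψ).curryLeft x = -theta x 0 ψ := by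
  simp [theta, AlternatingMap.curryLeftLinearMap]

theorem ext_curryLeft {q : ℕ} {ψ φ : Cochain K L M (q + 1)}
    (h : ∀ x, ψ.curryLeft x = φ.curryLeft x) : ψ = φ := by
  ext v
  rw [← Fin.cons_self_tail v]
  exact DFunLike.congr_fun (h (v 0)) (Fin.tail v)

theorem theta_lie {q : ℕ} (x y : L) (ψ : Cochain K L M q) :
    theta ⁅x, y⁆ q ψ = theta x q (theta y q ψ) - theta y q (theta x q ψ) := by
  induction q with
  | zero =>
    ext v
    simp [theta_apply, lieDer]
  | succ q ih =>
    refine ext_curryLeft fun z => ?_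
    rw [sub_eq_add_neg, AlternatingMap.curryLeft_add, LinearMap.add_apply, ← neg_one_smul K,
      AlternatingMap.curryLeft_smul, LinearMap.smul_apply]
    simp only [curryLeft_theta, ih, map_sub, neg_one_smul, lie_lie]
    abel

theorem theta_coboundary {q : ℕ} (x : L) (ψ : Cochain K L M q) :
    theta x (q + 1) (coboundary q ψ) = coboundary q (theta x q ψ) := by
  induction q with
  | zero =>
    refine ext_curryLeft fun y => ?_
    rw [curryLeft_theta]
    simp only [curryLeft_coboundary_zero, map_neg, theta_lie]
    abel
  | succ q ih =>
    refine ext_curryLeft fun y => ?_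
    rw [curryLeft_theta]
    simp only [curryLeft_coboundary, curryLeft_theta, map_neg, map_sub, theta_lie, ih]
    abel

/-- `δ_{q+1} ∘ δ_q = 0`. -/
theorem coboundary_coboundary {q : ℕ} (ψ : Cochain K L M q) :
    coboundary (q + 1) (coboundary q ψ) = 0 := by
  induction q with
  | zero =>
    refine ext_curryLeft fun y => ?_
    rw [curryLeft_coboundary, curryLeft_coboundary_zero, theta_coboundary]
    simp
  | succ q ih =>
    refine ext_curryLeft fun y => ?_
    rw [curryLeft_coboundary, curryLeft_coboundary, theta_coboundary]
    simp [ih]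

variable (K L M)

/-- The space `Z^q(L, M) = ker δ_q` of `q`-cocycles. -/
noncomputable def cocycles (q : ℕ) : Submodule K (Cochain K L M q) :=
  LinearMap.ker (coboundary q)

/-- The space `B^q(L, M) = im δ_{q-1}` of `q`-coboundaries (zero for `q = 0`). -/
noncomputable def coboundaries : (q : ℕ) → Submodule K (Cochain K L M q)
  | 0 => ⊥
  | q + 1 => LinearMap.range (coboundary q)

theorem coboundaries_le_cocycles (q : ℕ) : coboundaries K L M q ≤ cocycles K L M q := by
  cases q with
  | zero => exact bot_le
  | succ q =>
    rintro _ ⟨ψ, rfl⟩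
    exact coboundary_coboundary ψ

/-- The Chevalley–Eilenberg cohomology `H^q(L, M) = Z^q(L, M) / B^q(L, M)`. -/
abbrev Cohomology (q : ℕ) : Type _ :=
  cocycles K L M q ⧸ (coboundaries K L M q).submoduleOf (cocycles K L M q)

end ChevalleyEilenberg

/-! ### The Witt algebra -/

/-- The Witt algebra over `K`: the vector space with basis `e n`, `n : ℤ`, and the Lie bracket
determined by `⁅e n, e m⁆ = (m - n) • e (n + m)`. -/
def Witt (K : Type*) [Field K] : Type _ := ℤ →₀ K

namespace Witt

variable {K : Type*} [Field K]

noncomputable instance : AddCommGroup (Witt K) := inferInstanceAs (AddCommGroup (ℤ →₀ K))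

noncomputable instance : Module K (Witt K) := inferInstanceAs (Module K (ℤ →₀ K))

/-- The basis `e n`, `n : ℤ`, of the Witt algebra. -/
noncomputable def basis (K : Type*) [Field K] : Module.Basis ℤ K (Witt K) :=
  Module.Basis.ofRepr (LinearEquiv.refl K (ℤ →₀ K))

/-- The basis vector `e n` of the Witt algebra. -/
noncomputable def e (n : ℤ) : Witt K := basis K n

/-- The bilinear map with `(e n, e m) ↦ (m - n) • e (n + m)`. -/
noncomputable def bracketHom : Witt K →ₗ[K] Witt K →ₗ[K] Witt K :=
  (basis K).constr K fun n => (basis K).constr K fun m => ((m : K) - (n : K)) • e (n + m)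

theorem bracketHom_e (n m : ℤ) :
    bracketHom (e n) (e m : Witt K) = ((m : K) - (n : K)) • e (n + m) := by
  simp [bracketHom, e, Module.Basis.constr_basis]

theorem bracketHom_skew (x y : Witt K) : bracketHom x y = -bracketHom y x := by
  have h : (bracketHom : Witt K →ₗ[K] Witt K →ₗ[K] Witt K) = -bracketHom.flip := by
    refine (basis K).ext fun n => (basis K).ext fun m => ?_
    change bracketHom (e n) (e m) = -bracketHom (e m) (e n)
    rw [bracketHom_e, bracketHom_e, add_comm m n, ← neg_smul, neg_sub]
  exact LinearMap.congr_fun₂ h x y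

theorem bracketHom_self (x : Witt K) : bracketHom x x = 0 := by
  have hx : x ∈ Submodule.span K (Set.range (basis K)) := by
    rw [(basis K).span_eq]
    exact Submodule.mem_top
  induction hx using Submodule.span_induction with
  | mem y hy =>
    obtain ⟨n, rfl⟩ := hy
    change bracketHom (e n) (e n) = 0
    rw [bracketHom_e, sub_self, zero_smul]
  | zero => simp
  | add y z _ _ hy hz =>
    rw [map_add, map_add, LinearMap.add_apply, LinearMap.add_apply, hy, hz, bracketHom_skew y z]
    abel
  | smul c y _ hy => simp [hy]

theorem bracketHom_leibniz (x y z : Witt K) :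
    bracketHom x (bracketHom y z) =
      bracketHom (bracketHom x y) z + bracketHom y (bracketHom x z) := by
  have h : (LinearMap.llcomp K (Witt K) (Witt K) (Witt K)).compl₁₂ bracketHom bracketHom =
      LinearMap.compr₂ bracketHom bracketHom +
        ((LinearMap.llcomp K (Witt K) (Witt K) (Witt K)).compl₁₂ bracketHom bracketHom).flip := by
    refine (basis K).ext fun n => (basis K).ext fun m => (basis K).ext fun k => ?_
    change bracketHom (e n) (bracketHom (e m) (e k)) =
      bracketHom (bracketHom (e n) (e m)) (e k) + bracketHom (e m) (bracketHom (e n) (e k))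
    simp only [bracketHom_e, map_smul, LinearMap.smul_apply, smul_smul]
    rw [show n + m + k = n + (m + k) by ring, show m + (n + k) = n + (m + k) by ring, ← add_smul]
    congr 1
    push_cast
    ring
  exact LinearMap.congr_fun (LinearMap.congr_fun₂ h x y) z

noncomputable instance : LieRing (Witt K) where
  bracket x y := bracketHom x y
  add_lie x y z := by simp
  lie_add x y z := by simp
  lie_self := bracketHom_self
  leibniz_lie := bracketHom_leibniz

noncomputable instance : LieAlgebra K (Witt K) where
  lie_smul c x y := map_smul (bracketHom x) c y

theorem lie_e (n m : ℤ) : ⁅(e n : Witt K), (e m : Witt K)⁆ = ((m : K) - (n : K)) • e (n + m) :=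
  bracketHom_e n m

end Witt

/-! Split a cochain by degree: the component of degree `d` sends `(e_i, e_j, e_k)` into the line of
`e_{i+j+k+d}`, and `δ` preserves `d`. Since `e_0` acts on the component of degree `d` by the scalar
`d`, Cartan's formula turns the contraction with `e_0`, divided by `-d`, into a primitive when `d ≠
0` (`cob₂_eq_of_ne_zero`).

In degree zero a cocycle `F` is reduced to `0` by subtracting three coboundaries. Throughout,
Cartan's formula in the form `IsCocycle₃.lie_eq` says that `F` is invariant under `e_x` wherever its
contraction with `e_x` vanishes. (1) A recursively defined cochain achieves `F(-1, i, n) = 0` for `i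
≥ -1`; invariance under `e_{-1}` then kills `F` on indices `≥ -1`. (2) The freedom left in that
recursion is the sequence `φ(i, -2)`. It removes `F(1, j, -2)` for `j ≥ 0` and `F(2, 3, -2)`. The
values `F(i, j, -2)` with `i, j ≥ 1` satisfy a `2`-cocycle identity that now forces them to vanish
(`eq_zero_of_shifted_cocycle`), and `e_{-1}` carries this to `F(i, j, n) = 0` for all `i, j ≥ 0`
(`IsCocycle₃.eq_zero_of_nonneg_nonneg`). (3) A cochain supported on pairs of negative indices
removes `F(1, j, k)`; invariance under `e_1` and the cocycle identity at `(2, 3, j, k)` then kill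
`F` (`IsCocycle₃.eq_zero_of_nonneg`, `IsCocycle₃.eq_zero`).

Infinitely many degrees may occur, but the primitives in nonzero degrees only involve `ψ(e_0, e_i,
e_j)`, which is a finite combination of basis vectors, so they glue to an honest cochain
(`Witt.cocycle₃_mem_range`). -/

namespace WittCochain

variable {K : Type*} [Field K]

/-! ### Cochains of fixed degree, in coefficients -/

/-- Antisymmetry of a function of two integers. -/
def Alt₂ (φ : ℤ → ℤ → K) : Prop := ∀ i j, φ j i = -φ i j

/-- Antisymmetry of a function of three integers. -/
structure Alt₃ (F : ℤ → ℤ → ℤ → K) : Prop where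
  swap₁₂ : ∀ i j k, F j i k = -F i j k
  swap₂₃ : ∀ i j k, F i k j = -F i j k

/-- The coboundary of the `2`-cochain `(e_i, e_j) ↦ φ i j • e_{i+j+d}` of the Witt algebra, in
coefficients. -/
def cob₂ (d : ℤ) (φ : ℤ → ℤ → K) (a b c : ℤ) : K :=
  -((b + c + d - a) * φ b c - (b - a) * φ (a + b) c - (c - a) * φ b (a + c))
  + ((a + c + d - b) * φ a c - (c - b) * φ a (b + c)) - (a + b + d - c) * φ a b

/-- The coboundary of the `3`-cochain `(e_i, e_j, e_k) ↦ F i j k • e_{i+j+k+d}` of the Witt algebra,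
in coefficients. -/
def cob₃ (d : ℤ) (F : ℤ → ℤ → ℤ → K) (a b c e : ℤ) : K :=
  -((b + c + e + d - a) * F b c e - (b - a) * F (a + b) c e - (c - a) * F b (a + c) e
      - (e - a) * F b c (a + e))
  + ((a + c + e + d - b) * F a c e - (c - b) * F a (b + c) e - (e - b) * F a c (b + e))
  - ((a + b + e + d - c) * F a b e - (e - c) * F a b (c + e))
  + (a + b + c + d - e) * F a b c

theorem cob₃_cob₂ (φ : ℤ → ℤ → K) (h : Alt₂ φ) (a b c e : ℤ) :
    cob₃ 0 (cob₂ 0 φ) a b c e = 0 := by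
  simp only [cob₃, cob₂]
  push_cast
  rw [h (c + e) (a + b), h (b + e) (a + c),
    show b + (a + c) = a + b + c by ring, show a + (b + c) = a + b + c by ring,
    show b + (a + e) = a + b + e by ring, show a + (b + e) = a + b + e by ring,
    show c + (a + e) = a + c + e by ring, show a + (c + e) = a + c + e by ring,
    show c + (b + e) = b + c + e by ring, show b + (c + e) = b + c + e by ring]
  ring

theorem Alt₃.cob₂ {φ : ℤ → ℤ → K} (h : Alt₂ φ) (d : ℤ) : Alt₃ (cob₂ d φ) where
  swap₁₂ a b c := by
    simp only [WittCochain.cob₂]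
    rw [h a b, add_comm b a, h (b+c) a, h (a+c) b]
    ring
  swap₂₃ a b c := by
    simp only [WittCochain.cob₂]
    rw [h b c, h b (a+c), h (a+b) c, add_comm c b]
    ring

theorem Alt₃.eq_zero₁₂ [CharZero K] {F : ℤ → ℤ → ℤ → K} (h : Alt₃ F) (i k : ℤ) : F i i k = 0 :=
  self_eq_neg.mp (h.swap₁₂ i i k)

theorem Alt₃.eq_zero₂₃ [CharZero K] {F : ℤ → ℤ → ℤ → K} (h : Alt₃ F) (i k : ℤ) : F i k k = 0 :=
  self_eq_neg.mp (h.swap₂₃ i k k)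

theorem Alt₃.rotate {F : ℤ → ℤ → ℤ → K} (h : Alt₃ F) (i j k : ℤ) : F j k i = F i j k := by
  rw [h.swap₂₃, h.swap₁₂, neg_neg]

/-- The cocycle identity with first argument `0` is Cartan's formula for `e_0`: it expresses `d * F`
through the coboundary of the contraction `F 0`. -/
theorem cob₂_eq_of_ne_zero [CharZero K] {d : ℤ} (hd : d ≠ 0) {F : ℤ → ℤ → ℤ → K}
    (hc : ∀ a b c e, cob₃ d F a b c e = 0) : 
    cob₂ d (fun i j => -(F 0 i j / d)) = F := by
  have hd' : (d : K) ≠ 0 := by exact_mod_cast hd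
  funext a b c
  have h := hc 0 a b c
  simp only [cob₃, zero_add, Int.cast_zero] at h
  simp only [cob₂]
  field_simp
  linear_combination h

/-! ### Recursive construction of primitives -/

/-- Solution of the recursion `w (p+q) x(p,q) = α p x(p-1,q) + α q x(p,q-1) + g p q` in the first
quadrant. -/
noncomputable def quadrantSol (w α : ℤ → K) (g : ℤ → ℤ → K) (p q : ℤ) : K :=
  if 0 ≤ p ∧ 0 ≤ q then
    (α p * quadrantSol w α g (p - 1) q + α q * quadrantSol w α g p (q - 1) + g p q) / w (p + q)
  else 0
termination_by (p + q + 1).toNat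
decreasing_by all_goals omega

theorem quadrantSol_alt (w α : ℤ → K) (g : ℤ → ℤ → K) (hg : Alt₂ g) : Alt₂ (quadrantSol w α g) := by
  intro p q
  induction p, q using quadrantSol.induct with
  | case1 p q h h1 h2 =>
    rw [quadrantSol, quadrantSol.eq_1 w α g p q, if_pos h, if_pos h.symm, h1, h2, hg, add_comm q p]
    ring
  | case2 p q h =>
    rw [quadrantSol, quadrantSol.eq_1 w α g p q, if_neg h, if_neg (by tauto), neg_zero]

theorem quadrantSol_of_neg (w α : ℤ → K) (g : ℤ → ℤ → K) {p q : ℤ} (h : ¬ (0 ≤ p ∧ 0 ≤ q)) :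
    quadrantSol w α g p q = 0 := by
  rw [quadrantSol, if_neg h]

theorem quadrantSol_rec (w α : ℤ → K) (g : ℤ → ℤ → K) {p q : ℤ} (hp : 0 ≤ p) (hq : 0 ≤ q)
    (hw : w (p + q) ≠ 0) :
    w (p + q) * quadrantSol w α g p q =
      α p * quadrantSol w α g (p - 1) q + α q * quadrantSol w α g p (q - 1) + g p q := by
  rw [quadrantSol, if_pos ⟨hp, hq⟩]
  field_simp

/-- `bandSol g h i m` is the coefficient at `(e_i, e_{-2-m})` of the `2`-cochain `φ` with
`φ i (-2) = g i` and prescribed contraction of the coboundary with `e_{-1}`. -/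
noncomputable def bandSol (g : ℤ → K) (h : ℤ → ℤ → K) : ℕ → ℤ → K
  | 0, i => if 0 ≤ i then g i else 0
  | m + 1, i => if 0 ≤ i then ((i - 1 - m) * bandSol g h m i - (i + 1) * bandSol g h m (i - 1)
      + h i (-2 - m)) / (-1 - m) else 0

theorem exists_band [CharZero K] (g : ℤ → K) (h : ℤ → ℤ → K) :
    ∃ φ : ℤ → ℤ → K, Alt₂ φ ∧ (∀ i j, -1 ≤ i → -1 ≤ j → φ i j = 0) ∧
      (∀ i j, i ≤ -1 → j ≤ -1 → φ i j = 0) ∧ (∀ i, 0 ≤ i → φ i (-2) = g i) ∧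
      ∀ i n, 0 ≤ i → n ≤ -2 →
        (n + 1) * φ i (n - 1) = (i + n + 1) * φ i n - (i + 1) * φ (i - 1) n + h i n := by
  let u : ℤ → ℤ → K := fun i n => if n ≤ -2 then bandSol g h (-2 - n).toNat i else 0
  have hu : ∀ i n, (-2 < n ∨ i < 0) → u i n = 0 := by
    intro i n hi
    simp only [u]
    split_ifs with hn
    · have : ¬ 0 ≤ i := by omega
      cases (-2 - n).toNat <;> simp [bandSol, this]
    · rfl
  refine ⟨fun i j => u i j - u j i, fun i j => by ring, ?_, ?_, ?_, ?_⟩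
  · intro i j hi hj
    simp only []
    rw [hu i j (by omega), hu j i (by omega), sub_zero]
  · intro i j hi hj
    simp only []
    rw [hu i j (by omega), hu j i (by omega), sub_zero]
  · intro i hi
    simp only []
    rw [hu (-2) i (by omega)]
    simp [u, bandSol, hi]
  · intro i n hi hn
    simp only []
    rw [hu (n - 1) i (by omega), hu n i (by omega), hu n (i - 1) (by omega)]
    obtain ⟨m, rfl⟩ : ∃ m : ℕ, n = -2 - m := ⟨(-2 - n).toNat, by omega⟩
    have h1 : (-2 - (-2 - (m : ℤ) - 1)).toNat = m + 1 := by omega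
    have h2 : (-2 - (-2 - (m : ℤ))).toNat = m := by omega
    have h3 : (-1 - (m : K)) ≠ 0 := by
      have : (-1 - (m : ℤ)) ≠ 0 := by omega
      exact_mod_cast this
    simp only [u, h1, h2]
    rw [if_pos (by omega), if_pos (by omega), if_pos (by omega), bandSol, if_pos hi]
    push_cast
    field_simp
    ring

/-! ### Cocycles and coboundaries of degree zero -/

/-- Coefficients of a `3`-cocycle of degree zero of the Witt algebra. -/
structure IsCocycle₃ (F : ℤ → ℤ → ℤ → K) : Prop extends Alt₃ F where
  cob_eq_zero : ∀ a b c e, cob₃ 0 F a b c e = 0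

/-- Coefficients of a `3`-coboundary of degree zero of the Witt algebra. -/
def IsCoboundary₃ (F : ℤ → ℤ → ℤ → K) : Prop := ∃ φ, Alt₂ φ ∧ cob₂ 0 φ = F

theorem cob₂_add (d : ℤ) (φ χ : ℤ → ℤ → K) (a b c : ℤ) :
    cob₂ d (fun i j => φ i j + χ i j) a b c = cob₂ d φ a b c + cob₂ d χ a b c := by
  simp only [cob₂]; ring

theorem Alt₂.add {φ χ : ℤ → ℤ → K} (h : Alt₂ φ) (h' : Alt₂ χ) :
    Alt₂ fun i j => φ i j + χ i j := fun i j => by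
  simp only [h i j, h' i j]; ring

theorem IsCocycle₃.sub {F : ℤ → ℤ → ℤ → K} (hF : IsCocycle₃ F) {φ : ℤ → ℤ → K} (h : Alt₂ φ) :
    IsCocycle₃ fun a b c => F a b c - cob₂ 0 φ a b c where
  swap₁₂ a b c := by
    simp only [hF.swap₁₂ a b c, (Alt₃.cob₂ h 0).swap₁₂ a b c]; ring
  swap₂₃ a b c := by
    simp only [hF.swap₂₃ a b c, (Alt₃.cob₂ h 0).swap₂₃ a b c]; ring
  cob_eq_zero a b c e := by
    have h1 := hF.cob_eq_zero a b c e
    have h2 := cob₃_cob₂ φ h a b c e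
    simp only [cob₃] at h1 h2 ⊢
    linear_combination h1 - h2

theorem IsCoboundary₃.of_sub {F : ℤ → ℤ → ℤ → K} {φ : ℤ → ℤ → K} (h : Alt₂ φ)
    (hF : IsCoboundary₃ fun a b c => F a b c - cob₂ 0 φ a b c) : IsCoboundary₃ F := by
  obtain ⟨χ, hχ, e⟩ := hF
  refine ⟨_, h.add hχ, ?_⟩
  funext a b c
  rw [cob₂_add, e]
  ring

/-- Invariance of a cocycle under `e_x` wherever its contraction with `e_x` vanishes. -/
theorem IsCocycle₃.lie_eq {F : ℤ → ℤ → ℤ → K} (hF : IsCocycle₃ F) (x b c e : ℤ)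
    (h1 : F x c e = 0) (h2 : F x b e = 0) (h3 : F x b c = 0)
    (h4 : (c - b : K) * F x (b + c) e = 0) (h5 : (e - b : K) * F x c (b + e) = 0)
    (h6 : (e - c : K) * F x b (c + e) = 0) :
    (b + c + e - x) * F b c e =
      (b - x) * F (b + x) c e + (c - x) * F b (c + x) e + (e - x) * F b c (e + x) := by
  have h := hF.cob_eq_zero x b c e
  simp only [cob₃, Int.cast_zero] at h
  rw [add_comm x b, add_comm x c, add_comm x e] at h
  linear_combination -h + (x + c + e - b) * h1 - (x + b + e - c) * h2 + (x + b + c - e) * h3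
    - h4 - h5 + h6

/-- The recursion of `exists_band` is the equation `cob₂ 0 φ (-1) i n = h i n` solved for `φ i (n -
1)`, whose coefficient `n + 1` is nonzero for `n ≤ -2`. The band leaves the contraction at `n ≥ -1`
untouched, and `g` stays free for a second normalisation. -/
theorem exists_band_cob [CharZero K] (g : ℤ → K) (h : ℤ → ℤ → K) :
    ∃ φ : ℤ → ℤ → K, Alt₂ φ ∧ (∀ i j, -1 ≤ i → -1 ≤ j → φ i j = 0) ∧
      (∀ i j, i ≤ -1 → j ≤ -1 → φ i j = 0) ∧ (∀ i, 0 ≤ i → φ i (-2) = g i) ∧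
      ∀ i n, 0 ≤ i → cob₂ 0 φ (-1) i n = if n ≤ -2 then h i n else 0 := by
  obtain ⟨φ, hφ, h1, h2, h3, h4⟩ := exists_band g h
  refine ⟨φ, hφ, h1, h2, h3, fun i n hi => ?_⟩
  simp only [cob₂]
  rw [h1 (-1) i (by omega) (by omega)]
  split_ifs with hn
  · have h5 := h4 i n hi hn
    rw [h2 (-1) n (by omega) (by omega), show -1 + i = i - 1 by ring, show -1 + n = n - 1 by ring]
    have h6 : ((n : K) - i) * φ (-1) (i + n) = 0 := by
      by_cases hin : i + n ≤ -1
      · rw [h2 _ _ le_rfl hin, mul_zero]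
      · rw [h1 _ _ le_rfl (by omega), mul_zero]
    push_cast
    linear_combination h5 - h6
  · rw [h1 (-1) n (by omega) (by omega), h1 i n (by omega) (by omega),
      h1 (-1 + i) n (by omega) (by omega), h1 (-1) (i + n) (by omega) (by omega)]
    -- At `n = -1` the band value `φ i (-2)` does occur, but with coefficient `n + 1 = 0`.
    by_cases hn' : n = -1
    · subst hn'; norm_num
    · rw [h1 i (-1 + n) (by omega) (by omega)]; ring

/-! ### Normalisation along `e_{-1}` -/

/-- For `i, n ≥ 0` the equation is a recursion with leading coefficient `i + n + 1 ≠ 0`, solved by a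
cochain supported on that quadrant. The error that remains at `n ≤ -2` is absorbed by a band
cochain, which does not disturb the quadrant. -/
theorem IsCocycle₃.exists_contraction_eq [CharZero K] {F : ℤ → ℤ → ℤ → K} (hF : IsCocycle₃ F) :
    ∃ φ, Alt₂ φ ∧ ∀ i n, -1 ≤ i → F (-1) i n = cob₂ 0 φ (-1) i n := by
  let φ := quadrantSol (fun n => (n : K) + 1) (fun n => n + 1) (fun i j => -F (-1) i j)
  have hφ : Alt₂ φ := quadrantSol_alt _ _ _ fun i j => by simp only [hF.swap₂₃ (-1) i j]
  have hφ0 : ∀ i j, i < 0 ∨ j < 0 → φ i j = 0 := fun i j h => quadrantSol_of_neg _ _ _ (by omega)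
  have h1 : ∀ i n, 0 ≤ i → 0 ≤ n → F (-1) i n = cob₂ 0 φ (-1) i n := by
    intro i n hi hn
    have hw : (((i + n : ℤ) : K) + 1) ≠ 0 := by
      have : i + n + 1 ≠ 0 := by omega
      exact_mod_cast this
    have := quadrantSol_rec (fun n => (n : K) + 1) (fun n => n + 1) (fun i j => -F (-1) i j) hi hn hw
    change (((i + n : ℤ) : K) + 1) * φ i n =
      (i + 1) * φ (i - 1) n + (n + 1) * φ i (n - 1) + -F (-1) i n at this
    simp only [cob₂]
    rw [hφ0 (-1) n (by omega), hφ0 (-1) (i + n) (by omega), hφ0 (-1) i (by omega),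
      show -1 + i = i - 1 by ring, show -1 + n = n - 1 by ring]
    push_cast at this ⊢
    linear_combination this
  obtain ⟨χ, hχ, -, -, -, h2⟩ := exists_band_cob (K := K) 0
    (fun i n => F (-1) i n - cob₂ 0 φ (-1) i n)
  refine ⟨_, hφ.add hχ, fun i n hi => ?_⟩
  rw [cob₂_add]
  rcases eq_or_lt_of_le hi with rfl | hi
  · rw [hF.eq_zero₁₂, (Alt₃.cob₂ hφ 0).eq_zero₁₂, (Alt₃.cob₂ hχ 0).eq_zero₁₂, add_zero]
  · rw [h2 i n (by omega)]
    split_ifs with hn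
    · ring
    · rcases eq_or_lt_of_le (show -1 ≤ n by omega) with rfl | hn
      · rw [hF.swap₂₃, (Alt₃.cob₂ hφ 0).swap₂₃, hF.eq_zero₁₂, (Alt₃.cob₂ hφ 0).eq_zero₁₂, neg_zero,
          add_zero]
      · rw [h1 i n (by omega) (by omega), add_zero]

/-- Invariance under `e_{-1}` expresses `(i + j + k + 1) * F i j k` through values of smaller index
sum; the factor is positive once all indices are `≥ 0`. -/
theorem IsCocycle₃.eq_zero_of_neg_one_le [CharZero K] {F : ℤ → ℤ → ℤ → K} (hF : IsCocycle₃ F)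
    (h : ∀ i n, -1 ≤ i → F (-1) i n = 0) (i j k : ℤ) (hi : -1 ≤ i) (hj : -1 ≤ j) (hk : -1 ≤ k) :
    F i j k = 0 := by
  obtain ⟨m, hm⟩ : ∃ m : ℕ, i + j + k + 3 = m := ⟨(i + j + k + 3).toNat, by omega⟩
  induction m using Nat.strong_induction_on generalizing i j k with
  | _ m ih =>
    rcases eq_or_lt_of_le hi with rfl | hi
    · exact h _ _ hj
    rcases eq_or_lt_of_le hj with rfl | hj
    · rw [hF.swap₁₂, h i k hi.le, neg_zero]
    rcases eq_or_lt_of_le hk with rfl | hk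
    · rw [hF.rotate (-1) i j, h i j hi.le]
    have e := hF.lie_eq (-1) i j k (h _ _ (by omega)) (h _ _ (by omega)) (h _ _ (by omega))
      (by rw [h _ _ (by omega), mul_zero]) (by rw [h _ _ (by omega), mul_zero])
      (by rw [h _ _ (by omega), mul_zero])
    rw [ih (m - 1) (by omega) (i + -1) j k (by omega) (by omega) (by omega) (by omega),
      ih (m - 1) (by omega) i (j + -1) k (by omega) (by omega) (by omega) (by omega),
      ih (m - 1) (by omega) i j (k + -1) (by omega) (by omega) (by omega) (by omega)] at e
    have hs : ((i : K) + j + k - (-1 : ℤ)) ≠ 0 := by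
      have : i + j + k - (-1) ≠ 0 := by omega
      exact_mod_cast this
    simp only [mul_zero, add_zero] at e
    exact (mul_eq_zero.mp e).resolve_left hs

theorem exists_seq [CharZero K] (h : ℤ → K) (c : K) :
    ∃ g : ℤ → K, g 1 = 0 ∧ 3 * g 0 = h 0 ∧
      (∀ j : ℤ, 2 ≤ j → (j - 1) * g (j + 1) = (j - 3) * g j + h j) ∧ g 3 + g 5 - 3 * g 2 = c := by
  -- The starting value is `g 2`, the only free one. The factor `j - 3` makes `g 4`, hence `g 5`,
  -- independent of it, and `g 3 = h 2 - g 2`; so the last condition is linear in `g 2` with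
  -- coefficient `-4`.
  let u : ℕ → K := fun m => Nat.rec ((h 2 + (h 3 / 2 + h 4) / 3 - c) / 4)
    (fun m y => ((m - 1) * y + h (m + 2)) / (m + 1)) m
  have hu0 : u 0 = (h 2 + (h 3 / 2 + h 4) / 3 - c) / 4 := rfl
  have hu : ∀ m : ℕ, u (m + 1) = ((m - 1) * u m + h (m + 2)) / (m + 1) := fun m => rfl
  refine ⟨fun j => if j = 0 then h 0 / 3 else if j = 1 then 0 else u (j - 2).toNat, ?_, ?_, ?_, ?_⟩
  · simp
  · simp; field_simp
  · intro j hj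
    obtain ⟨m, rfl⟩ : ∃ m : ℕ, j = m + 2 := ⟨(j - 2).toNat, by omega⟩
    simp only []
    rw [if_neg (by omega), if_neg (by omega), if_neg (by omega), if_neg (by omega),
      show ((m : ℤ) + 2 + 1 - 2).toNat = m + 1 by omega, show ((m : ℤ) + 2 - 2).toNat = m by omega,
      hu]
    have : (m : K) + 1 ≠ 0 := by exact_mod_cast m.succ_ne_zero
    push_cast
    field_simp
    ring
  · have h1 := hu 0
    have h2 := hu 1
    have h3 := hu 2
    norm_num at h1 h2 h3
    norm_num
    simp only [show ((3 : ℤ)).toNat = 3 from rfl]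
    rw [h3, h2, h1, hu0]
    field_simp
    ring

/-- Band cochains with `h = 0` preserve the first normalisation. For them the remaining conditions
concern only `g i = φ i (-2)`, and they are exactly the ones solved by `exists_seq`. -/
theorem IsCocycle₃.exists_second_eq [CharZero K] {F : ℤ → ℤ → ℤ → K} (hF : IsCocycle₃ F) :
    ∃ φ, Alt₂ φ ∧ (∀ i n, -1 ≤ i → cob₂ 0 φ (-1) i n = 0) ∧
      (∀ j, 0 ≤ j → F 1 j (-2) = cob₂ 0 φ 1 j (-2)) ∧ F 2 3 (-2) = cob₂ 0 φ 2 3 (-2) := by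
  obtain ⟨g, g1, g0, hg, gc⟩ := exists_seq (fun j => F 1 j (-2)) (F 2 3 (-2))
  obtain ⟨φ, hφ, h1, h2, h3, h4⟩ := exists_band_cob g 0
  have key : ∀ i j, 1 ≤ i → 1 ≤ j → cob₂ 0 φ i j (-2) =
      -((j - 2 - i) * g j - (j - i) * g (i + j)) + (i - 2 - j) * g i := by
    intro i j hi hj
    simp only [cob₂]
    rw [h3 i (by omega), h3 j (by omega), h3 (i + j) (by omega), h1 i j (by omega) (by omega),
      h1 j (i + -2) (by omega) (by omega), h1 i (j + -2) (by omega) (by omega)]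
    push_cast
    ring
  refine ⟨φ, hφ, fun i n hi => ?_, fun j hj => ?_, ?_⟩
  · rcases eq_or_lt_of_le hi with rfl | hi
    · exact (Alt₃.cob₂ hφ 0).eq_zero₁₂ _ _
    · rw [h4 i n (by omega)]; simp
  · rcases eq_or_lt_of_le hj with rfl | hj
    · simp only [cob₂]
      norm_num
      rw [h3 0 le_rfl, h3 1 (by omega), g1, h1 0 (-1) (by omega) (by omega),
        h1 1 0 (by omega) (by omega)]
      linear_combination -g0
    rcases eq_or_lt_of_le (show 1 ≤ j by omega) with rfl | hj
    · rw [hF.eq_zero₁₂, (Alt₃.cob₂ hφ 0).eq_zero₁₂]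
    · have := hg j (by omega)
      rw [key 1 j le_rfl (by omega), g1, add_comm 1 j]
      push_cast
      linear_combination -this
  · rw [key 2 3 (by omega) (by omega), ← gc]
    norm_num
    ring

/-- Alternating functions `f` on positive integers that satisfy the `2`-cocycle identity with values
in the shift by `-2` of the adjoint module. -/
theorem eq_zero_of_shifted_cocycle [CharZero K] {f : ℤ → ℤ → K} (hf : Alt₂ f)
    (hA : ∀ i j k ij ik jk : ℤ, 1 ≤ i → 1 ≤ j → 1 ≤ k → ij = i + j → ik = i + k → jk = j + k →
      -(j + k - 2 - i) * f j k + (j - i) * f ij k + (k - i) * f j ik + (i + k - 2 - j) * f i k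
        - (k - j) * f i jk - (i + j - 2 - k) * f i j = 0)
    (h1 : ∀ j, 1 ≤ j → f 1 j = 0) (h23 : f 2 3 = 0) (i j : ℤ) (hi : 1 ≤ i) (hj : 1 ≤ j) :
    f i j = 0 := by
  have hd : ∀ i, f i i = 0 := fun i => self_eq_neg.mp (hf i i)
  -- Invariance under `e_1`, since `f 1` vanishes.
  have hB : ∀ j k j' k' : ℤ, 1 ≤ j → 1 ≤ k → j' = j + 1 → k' = k + 1 →
      (j + k - 3) * f j k = (j - 1) * f j' k + (k - 1) * f j k' := by
    intro j k j' k' hj hk hj' hk'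
    have h := hA 1 j k j' k' (j + k) le_rfl hj hk (by omega) (by omega) rfl
    rw [h1 j hj, h1 k hk, h1 (j + k) (by omega)] at h
    push_cast at h
    linear_combination -h
  -- The weight `2 + 5 = 7` is exceptional: the induction below yields a factor `k - 5` in front of
  -- `f 2 k`. An explicit combination of relations in weights `7` to `12` settles it.
  have h25 : f 2 5 = 0 := by
    have b27 := hB 2 7 3 8 (by norm_num) (by norm_num) (by norm_num) (by norm_num)
    have b28 := hB 2 8 3 9 (by norm_num) (by norm_num) (by norm_num) (by norm_num)
    have b29 := hB 2 9 3 10 (by norm_num) (by norm_num) (by norm_num) (by norm_num)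
    have b34 := hB 3 4 4 5 (by norm_num) (by norm_num) (by norm_num) (by norm_num)
    have b35 := hB 3 5 4 6 (by norm_num) (by norm_num) (by norm_num) (by norm_num)
    have b36 := hB 3 6 4 7 (by norm_num) (by norm_num) (by norm_num) (by norm_num)
    have b37 := hB 3 7 4 8 (by norm_num) (by norm_num) (by norm_num) (by norm_num)
    have b38 := hB 3 8 4 9 (by norm_num) (by norm_num) (by norm_num) (by norm_num)
    have b45 := hB 4 5 5 6 (by norm_num) (by norm_num) (by norm_num) (by norm_num)
    have b46 := hB 4 6 5 7 (by norm_num) (by norm_num) (by norm_num) (by norm_num)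
    have b47 := hB 4 7 5 8 (by norm_num) (by norm_num) (by norm_num) (by norm_num)
    have b56 := hB 5 6 6 7 (by norm_num) (by norm_num) (by norm_num) (by norm_num)
    have a234 := hA 2 3 4 5 6 7 (by norm_num) (by norm_num) (by norm_num) (by norm_num)
      (by norm_num) (by norm_num)
    have a235 := hA 2 3 5 5 7 8 (by norm_num) (by norm_num) (by norm_num) (by norm_num)
      (by norm_num) (by norm_num)
    have a236 := hA 2 3 6 5 8 9 (by norm_num) (by norm_num) (by norm_num) (by norm_num)
      (by norm_num) (by norm_num)
    have a237 := hA 2 3 7 5 9 10 (by norm_num) (by norm_num) (by norm_num) (by norm_num)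
      (by norm_num) (by norm_num)
    have a245 := hA 2 4 5 6 7 9 (by norm_num) (by norm_num) (by norm_num) (by norm_num)
      (by norm_num) (by norm_num)
    have a246 := hA 2 4 6 6 8 10 (by norm_num) (by norm_num) (by norm_num) (by norm_num)
      (by norm_num) (by norm_num)
    have a345 := hA 3 4 5 7 8 9 (by norm_num) (by norm_num) (by norm_num) (by norm_num)
      (by norm_num) (by norm_num)
    push_cast at *
    rw [hd] at b34 b45 b56 a235 a246
    rw [hf 4 5] at a234
    rw [hf 5 6] at a245
    rw [hf 5 7] at a345
    linear_combination (5 / 4) * h23 - (1 / 8) * b27 - (3 / 20) * b28 + (11 / 160) * b29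
      - (3 / 4) * b34 - (43 / 160) * b35 + (19 / 80) * b36 + (13 / 80) * b37 + (17 / 320) * b38
      + (13 / 40) * b45 + (1 / 8) * b46 - (59 / 160) * b47 + (23 / 64) * b56
      - a234 - (3 / 20) * a235 + (1 / 10) * a236 - (1 / 16) * a237 + (13 / 10) * a245
      - (3 / 20) * a246 - (241 / 320) * a345
  obtain ⟨w, hw⟩ : ∃ w : ℕ, i + j = w := ⟨(i + j).toNat, by omega⟩
  induction w using Nat.strong_induction_on generalizing i j with
  | _ w ih =>
    -- With lower weights zero, the `e_1` relation has two terms, so all values of weight `w` are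
    -- governed by `f 2 (w - 2)`.
    have hB0 : ∀ j k j' k' : ℤ, 1 ≤ j → 1 ≤ k → j' = j + 1 → k' = k + 1 → j + k + 1 = w →
        (j - 1) * f j' k = -((k - 1) * f j k') := by
      intro j k j' k' hj hk hj' hk' hw
      have := hB j k j' k' hj hk hj' hk'
      rw [ih (w - 1) (by omega) j k hj hk (by omega)] at this
      linear_combination -this
    have h2 : ∀ k : ℤ, 1 ≤ k → 2 + k = w → f 2 k = 0 := by
      intro k hk hkw
      by_cases hk6 : k ≤ 5
      · obtain rfl | rfl | rfl | rfl | rfl : k = 1 ∨ k = 2 ∨ k = 3 ∨ k = 4 ∨ k = 5 := by omega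
        · rw [hf 1 2, h1 2 (by norm_num), neg_zero]
        · exact hd 2
        · exact h23
        · have := hB0 2 3 3 4 (by norm_num) (by norm_num) (by norm_num) (by norm_num) (by omega)
          rw [hd] at this
          push_cast at this
          linear_combination (1 / 2) * this
        · exact h25
      · have e1 := hB0 2 (k - 1) 3 k (by norm_num) (by omega) (by norm_num) (by omega) (by omega)
        have e2 := hB0 3 (k - 2) 4 (k - 1) (by norm_num) (by omega) (by norm_num) (by omega)
          (by omega)
        have e3 := hB0 4 (k - 3) 5 (k - 2) (by norm_num) (by omega) (by norm_num) (by omega)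
          (by omega)
        have e4 := hA 2 3 (k - 3) 5 (k - 1) k (by norm_num) (by norm_num) (by omega) (by norm_num)
          (by omega) (by omega)
        rw [ih (w - 2) (by omega) 3 (k - 3) (by norm_num) (by omega) (by omega),
          ih (w - 3) (by omega) 2 (k - 3) (by norm_num) (by omega) (by omega), h23] at e4
        push_cast at e1 e2 e3 e4
        -- The relations `e1`, `e2`, `e3` express `f 3 (k - 1)` and `f 5 (k - 3)` by `f 2 k`;
        -- inserted in the cocycle identity at `(2, 3, k - 3)`, they leave `k (k - 5) (k + 2) * f 2
        -- k = 0`.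
        have hk' : ((k - 5 : ℤ) : K) * ((k ^ 2 + 2 * k : ℤ) : K) ≠ 0 := by
          have : (k - 5) * (k ^ 2 + 2 * k) ≠ 0 := mul_ne_zero (by omega) (by positivity)
          exact_mod_cast this
        refine (mul_eq_zero.mp (?_ : _ * f 2 k = 0)).resolve_left hk'
        push_cast
        linear_combination -6 * e4 + 2 * e3 - (k - 4) * e2
          + ((k - 4) * (k - 3) + 6 * (k - 5)) * e1
    rcases eq_or_lt_of_le hi with rfl | hi
    · exact h1 j hj
    induction i, Int.add_one_le_iff.mpr hi using Int.leInduction generalizing j with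
    | base => exact h2 j hj hw
    | succ i hi' ih' =>
      have hi' : 2 ≤ i := hi'
      have h := hB0 i j (i + 1) (j + 1) (by omega) hj rfl rfl (by omega)
      rw [ih' (j + 1) (by omega) (by omega) (by omega) (by omega), mul_zero, neg_zero] at h
      have hne : (i : K) - 1 ≠ 0 := by
        have : i - 1 ≠ 0 := by omega
        exact_mod_cast this
      exact (mul_eq_zero.mp h).resolve_left hne

/-- The case `n = -2` is decisive. For larger `n` all indices are `≥ -1`; for smaller `n`,
invariance under `e_{-1}` lowers `n` step by step. -/
theorem IsCocycle₃.eq_zero_of_nonneg_nonneg [CharZero K] {F : ℤ → ℤ → ℤ → K} (hF : IsCocycle₃ F)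
    (hm : ∀ i n, -1 ≤ i → F (-1) i n = 0) (h1 : ∀ j, 0 ≤ j → F 1 j (-2) = 0)
    (h23 : F 2 3 (-2) = 0) (i j n : ℤ) (hi : 0 ≤ i) (hj : 0 ≤ j) : F i j n = 0 := by
  have hB := hF.eq_zero_of_neg_one_le hm
  have pos : ∀ i j, 1 ≤ i → 1 ≤ j → F i j (-2) = 0 := by
    refine eq_zero_of_shifted_cocycle (f := fun i j => F i j (-2)) (fun i j => hF.swap₁₂ _ _ _) ?_
      (fun j hj => h1 j (by omega)) h23
    rintro i j k _ _ _ hi hj hk rfl rfl rfl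
    have h := hF.cob_eq_zero i j k (-2)
    simp only [cob₃] at h
    rw [hB i j k (by omega) (by omega) (by omega), hB j k (i + -2) (by omega) (by omega) (by omega),
      hB i k (j + -2) (by omega) (by omega) (by omega),
      hB i j (k + -2) (by omega) (by omega) (by omega)] at h
    push_cast at h
    linear_combination h
  have zero : ∀ k, 0 ≤ k → F 0 k (-2) = 0 := by
    have hrec : ∀ k : ℤ, 0 ≤ k → (k - 3) * F 0 k (-2) = (k - 1) * F 0 (k + 1) (-2) := by
      intro k hk
      have h := hF.lie_eq 1 0 k (-2) (h1 k hk) (h1 0 le_rfl) (hB 1 0 k (by omega) (by omega) (by omega))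
        (by rw [zero_add, h1 k hk, mul_zero]) (by rw [zero_add, h1 k hk, mul_zero]) (by
          by_cases hk0 : k = 0
          · rw [hk0, zero_add, h1 0 le_rfl, mul_zero]
          · rw [hB 1 0 (k + -2) (by omega) (by omega) (by omega), mul_zero])
      rw [zero_add, h1 k hk, hB 0 k (-2 + 1) (by omega) (by omega) (by omega)] at h
      push_cast at h
      linear_combination h
    -- The factor `k - 3` vanishes at `k = 3`.
    have z4 : F 0 4 (-2) = 0 := by
      have h3 := hrec 3 (by norm_num)
      norm_num at h3
      exact h3
    have z5 : F 0 5 (-2) = 0 := by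
      have h4 := hrec 4 (by norm_num)
      norm_num [z4] at h4
      exact h4
    -- The cocycle identity at `(0, 2, 3, -2)` gives `F 0 3 (-2) = 3 * F 0 2 (-2)`, whereas the
    -- recursion at `k = 2` gives `F 0 3 (-2) = -F 0 2 (-2)`.
    have z2 : F 0 2 (-2) = 0 := by
      have h2 := hrec 2 (by norm_num)
      have h := hF.cob_eq_zero 0 2 3 (-2)
      simp only [cob₃] at h
      norm_num at h h2
      rw [hB 0 3 0 (by omega) (by omega) (by omega), z5,
        hB 0 2 1 (by omega) (by omega) (by omega), hB 0 2 3 (by omega) (by omega) (by omega)] at h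
      linear_combination (1 / 4) * h - (1 / 4) * h2
    intro k hk
    by_cases hk2 : 2 ≤ k
    · induction k, hk2 using Int.leInduction with
      | base => exact z2
      | succ k hk2 ih =>
        have h := hrec k (by omega)
        rw [ih (by omega), mul_zero] at h
        have hne : (k : K) - 1 ≠ 0 := by
          have : k - 1 ≠ 0 := by omega
          exact_mod_cast this
        exact (mul_eq_zero.mp h.symm).resolve_left hne
    · obtain rfl | rfl : k = 0 ∨ k = 1 := by omega
      · exact hF.eq_zero₁₂ _ _
      · rw [hF.swap₁₂, h1 0 le_rfl, neg_zero]
  have two : ∀ i j, 0 ≤ i → 0 ≤ j → F i j (-2) = 0 := by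
    intro i j hi hj
    rcases eq_or_lt_of_le hi with rfl | hi
    · exact zero j hj
    rcases eq_or_lt_of_le hj with rfl | hj
    · rw [hF.swap₁₂, zero i hi.le, neg_zero]
    · exact pos i j hi hj
  by_cases hn : -1 ≤ n
  · exact hB i j n (by omega) (by omega) hn
  obtain ⟨m, rfl⟩ : ∃ m : ℕ, n = -2 - m := ⟨(-2 - n).toNat, by omega⟩
  clear hn
  induction m generalizing i j with
  | zero => exact two i j hi hj
  | succ m ih =>
    have h0 : ∀ i j, -1 ≤ i → -1 ≤ j → F i j (-2 - m) = 0 := by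
      intro i j hi hj
      rcases eq_or_lt_of_le hi with rfl | hi
      · exact hm j _ hj
      rcases eq_or_lt_of_le hj with rfl | hj
      · rw [hF.swap₁₂, hm i _ hi.le, neg_zero]
      · exact ih i j (by omega) (by omega)
    have h := hF.lie_eq (-1) i j (-2 - m) (hm _ _ (by omega)) (hm _ _ (by omega))
      (hm _ _ (by omega)) (by rw [hm _ _ (by omega), mul_zero])
      (by rw [hm _ _ (by omega), mul_zero]) (by rw [hm _ _ (by omega), mul_zero])
    rw [h0 i j (by omega) (by omega), h0 (i + -1) j (by omega) (by omega),
      h0 i (j + -1) (by omega) (by omega)] at h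
    have hne : (((-2 - m : ℤ) : K) - (-1 : ℤ)) ≠ 0 := by
      have : (-2 - m : ℤ) - (-1) ≠ 0 := by omega
      exact_mod_cast this
    rw [show (-2 - (m + 1 : ℕ) : ℤ) = -2 - m + -1 by push_cast; ring]
    simp only [mul_zero, zero_add] at h
    exact (mul_eq_zero.mp h.symm).resolve_left hne

/-! ### Normalisation along `e_1` -/

/-- A cochain supported on pairs of negative indices has a coboundary that vanishes on two
nonnegative arguments, so the previous vanishing survives. On negative pairs the equation is a
recursion towards `-∞` with leading coefficient `j + k - 1 ≠ 0`. -/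
theorem IsCocycle₃.exists_first_eq [CharZero K] {F : ℤ → ℤ → ℤ → K} (hF : IsCocycle₃ F)
    (hP : ∀ i j n, 0 ≤ i → 0 ≤ j → F i j n = 0) :
    ∃ φ, Alt₂ φ ∧ (∀ i j n, 0 ≤ i → 0 ≤ j → cob₂ 0 φ i j n = 0) ∧
      ∀ j k, F 1 j k = cob₂ 0 φ 1 j k := by
  -- The reflection `p = -1 - j` carries negative indices to the quadrant `p, q ≥ 0`.
  let x := quadrantSol (fun n => -(n : K) - 3) (fun n => -(n : K) - 2)
    (fun p q => -F 1 (-1 - p) (-1 - q))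
  have hx : Alt₂ x := quadrantSol_alt _ _ _ fun i j => by simp only [hF.swap₂₃ 1 (-1 - i)]
  have hx0 : ∀ p q, p < 0 ∨ q < 0 → x p q = 0 := fun p q h => quadrantSol_of_neg _ _ _ (by omega)
  let φ : ℤ → ℤ → K := fun j k => x (-1 - j) (-1 - k)
  have hφ : Alt₂ φ := fun j k => hx _ _
  have hφ0 : ∀ j k, 0 ≤ j ∨ 0 ≤ k → φ j k = 0 := fun j k h => hx0 _ _ (by omega)
  have hP' : ∀ i j n, 0 ≤ i → 0 ≤ j → cob₂ 0 φ i j n = 0 := by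
    intro i j n hi hj
    simp only [cob₂]
    rw [hφ0 j n (by omega), hφ0 (i + j) n (by omega), hφ0 j (i + n) (by omega),
      hφ0 i n (by omega), hφ0 i (j + n) (by omega), hφ0 i j (by omega)]
    ring
  refine ⟨φ, hφ, hP', fun j k => ?_⟩
  by_cases hj : 0 ≤ j
  · rw [hP 1 j k (by omega) hj, hP' 1 j k (by omega) hj]
  by_cases hk : 0 ≤ k
  · rw [hF.swap₂₃ 1 k j, (Alt₃.cob₂ hφ 0).swap₂₃ 1 k j, hP 1 k j (by omega) hk,
      hP' 1 k j (by omega) hk]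
  have hw : -(((-1 - j + (-1 - k) : ℤ)) : K) - 3 ≠ 0 := by
    have : -(-1 - j + (-1 - k)) - 3 ≠ 0 := by omega
    exact_mod_cast this
  have h : (-(((-1 - j + (-1 - k) : ℤ)) : K) - 3) * φ j k =
      (-((-1 - j : ℤ) : K) - 2) * x (-1 - j - 1) (-1 - k) +
      (-((-1 - k : ℤ) : K) - 2) * x (-1 - j) (-1 - k - 1) +
      -F 1 (-1 - (-1 - j)) (-1 - (-1 - k)) :=
    quadrantSol_rec (fun n => -(n : K) - 3) (fun n => -(n : K) - 2) _
      (by omega) (by omega) hw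
  rw [show -1 - j - 1 = -1 - (1 + j) by ring, show -1 - k - 1 = -1 - (1 + k) by ring,
    sub_sub_cancel, sub_sub_cancel] at h
  change _ = _ * φ (1 + j) k + _ * φ j (1 + k) + _ at h
  simp only [cob₂]
  rw [hφ0 1 k (by omega), hφ0 1 (j + k) (by omega), hφ0 1 j (by omega)]
  push_cast at h ⊢
  linear_combination h

/-- Induction on `-j - k` for negative `j`, `k`: modulo larger `j + k`, invariance under `e_1` is a
recursion in `i` alone, which reduces the case `i ≥ 2` to `F 2 j k`. -/
theorem IsCocycle₃.eq_zero_of_nonneg [CharZero K] {F : ℤ → ℤ → ℤ → K} (hF : IsCocycle₃ F)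
    (hP : ∀ i j n, 0 ≤ i → 0 ≤ j → F i j n = 0) (h1 : ∀ j k, F 1 j k = 0) (i j k : ℤ)
    (hi : 0 ≤ i) : F i j k = 0 := by
  by_cases hj : 0 ≤ j
  · exact hP i j k hi hj
  by_cases hk : 0 ≤ k
  · rw [hF.swap₂₃, hP i k j hi hk, neg_zero]
  by_cases hjk : j = k
  · rw [hjk, hF.eq_zero₂₃]
  obtain ⟨m, hm⟩ : ∃ m : ℕ, -j - k = m := ⟨(-j - k).toNat, by omega⟩
  induction m using Nat.strong_induction_on generalizing i j k with
  | _ m ih =>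
    have up : ∀ i' j' k', 0 ≤ i' → j + k < j' + k' → F i' j' k' = 0 := by
      intro i' j' k' hi' hlt
      by_cases hj' : 0 ≤ j'
      · exact hP i' j' k' hi' hj'
      by_cases hk' : 0 ≤ k'
      · rw [hF.swap₂₃, hP i' k' j' hi' hk', neg_zero]
      by_cases hjk' : j' = k'
      · rw [hjk', hF.eq_zero₂₃]
      exact ih (-j' - k').toNat (by omega) i' j' k' hi' hj' hk' hjk' (by omega)
    have hrec : ∀ i : ℤ, 0 ≤ i → (i + j + k - 1) * F i j k = (i - 1) * F (i + 1) j k := by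
      intro i hi
      have h := hF.lie_eq 1 i j k (h1 _ _) (h1 _ _) (h1 _ _) (by rw [h1, mul_zero])
        (by rw [h1, mul_zero]) (by rw [h1, mul_zero])
      rw [up i (j + 1) k hi (by omega), up i j (k + 1) hi (by omega)] at h
      push_cast at h
      linear_combination h
    have z2 : F 2 j k = 0 := by
      have r2 := hrec 2 (by norm_num)
      have r3 := hrec 3 (by norm_num)
      have r4 := hrec 4 (by norm_num)
      have h := hF.cob_eq_zero 2 3 j k
      simp only [cob₃] at h
      rw [up 3 (2 + j) k (by norm_num) (by omega), up 3 j (2 + k) (by norm_num) (by omega),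
        up 2 (3 + j) k (by norm_num) (by omega), up 2 j (3 + k) (by norm_num) (by omega),
        hP 2 3 k (by norm_num) (by norm_num), hP 2 3 (j + k) (by norm_num) (by norm_num),
        hP 2 3 j (by norm_num) (by norm_num)] at h
      norm_num at h r2 r3 r4
      -- With `s = j + k`, eliminating `F 3 j k`, `F 4 j k` and `F 5 j k` from the cocycle identity
      -- at `(2, 3, j, k)` leaves `(s - 1) (s ^ 2 + s + 6) * F 2 j k = 0`. Here `s < 0`, and the
      -- quadratic factor is positive.
      have hne : ((j + k - 1 : ℤ) : K) * (((j + k) ^ 2 + (j + k) + 6 : ℤ) : K) ≠ 0 := by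
        have : (j + k - 1) * ((j + k) ^ 2 + (j + k) + 6) ≠ 0 :=
          mul_ne_zero (by omega) (by nlinarith [sq_nonneg (j + k + 1)])
        exact_mod_cast this
      refine (mul_eq_zero.mp (?_ : _ * F 2 j k = 0)).resolve_left hne
      push_cast
      linear_combination 6 * h + 2 * r4 + (j + k + 3) * r3
        + ((j + k + 3) * (j + k + 2) - 6 * (j + k + 1)) * r2
    by_cases hi2 : 2 ≤ i
    · induction i, hi2 using Int.leInduction with
      | base => exact z2
      | succ i hi2 ih' =>
        have h := hrec i (by omega)
        rw [ih' (by omega), mul_zero] at h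
        have hne : (i : K) - 1 ≠ 0 := by
          have : i - 1 ≠ 0 := by omega
          exact_mod_cast this
        exact (mul_eq_zero.mp h.symm).resolve_left hne
    · obtain rfl | rfl : i = 0 ∨ i = 1 := by omega
      · have h := hrec 0 le_rfl
        rw [zero_add, h1, mul_zero] at h
        have hne : ((0 : ℤ) : K) + j + k - 1 ≠ 0 := by
          have : 0 + j + k - 1 ≠ 0 := by omega
          exact_mod_cast this
        exact (mul_eq_zero.mp h).resolve_left hne
      · exact h1 _ _

/-- For negative indices, invariance under `e_1` expresses `(i + j + k - 1) * F i j k` through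
values with one index raised; the factor is negative. -/
theorem IsCocycle₃.eq_zero [CharZero K] {F : ℤ → ℤ → ℤ → K} (hF : IsCocycle₃ F)
    (hP : ∀ i j k, 0 ≤ i → F i j k = 0) (i j k : ℤ) : F i j k = 0 := by
  obtain ⟨m, hm⟩ : ∃ m : ℕ, (-i).toNat + (-j).toNat + (-k).toNat = m := ⟨_, rfl⟩
  induction m using Nat.strong_induction_on generalizing i j k with
  | _ m ih =>
    by_cases hi : 0 ≤ i
    · exact hP i j k hi
    by_cases hj : 0 ≤ j
    · rw [hF.swap₁₂, hP j i k hj, neg_zero]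
    by_cases hk : 0 ≤ k
    · rw [← hF.rotate, ← hF.rotate, hP k i j hk]
    have h := hF.lie_eq 1 i j k (hP _ _ _ zero_le_one) (hP _ _ _ zero_le_one)
      (hP _ _ _ zero_le_one) (by rw [hP _ _ _ zero_le_one, mul_zero])
      (by rw [hP _ _ _ zero_le_one, mul_zero]) (by rw [hP _ _ _ zero_le_one, mul_zero])
    rw [ih (m - 1) (by omega) (i + 1) j k (by omega), ih (m - 1) (by omega) i (j + 1) k (by omega),
      ih (m - 1) (by omega) i j (k + 1) (by omega)] at h
    have hne : (i : K) + j + k - (1 : ℤ) ≠ 0 := by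
      have : i + j + k - 1 ≠ 0 := by omega
      exact_mod_cast this
    simp only [mul_zero, add_zero] at h
    exact (mul_eq_zero.mp h).resolve_left hne

theorem isCoboundary₃_zero : IsCoboundary₃ (fun _ _ _ => (0 : K)) :=
  ⟨fun _ _ => 0, fun _ _ => neg_zero.symm, by funext a b c; simp [cob₂]⟩

theorem IsCocycle₃.isCoboundary₃_of_nonneg_nonneg [CharZero K] {F : ℤ → ℤ → ℤ → K}
    (hF : IsCocycle₃ F) (hP : ∀ i j n, 0 ≤ i → 0 ≤ j → F i j n = 0) : IsCoboundary₃ F := by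
  obtain ⟨φ, hφ, h0, h1⟩ := hF.exists_first_eq hP
  refine .of_sub hφ ?_
  have hG := hF.sub hφ
  have hz := hG.eq_zero (hG.eq_zero_of_nonneg
    (fun i j n hi hj => by rw [hP i j n hi hj, h0 i j n hi hj, sub_zero])
    (fun j k => sub_eq_zero.mpr (h1 j k)))
  simp only [hz]
  exact isCoboundary₃_zero

theorem IsCocycle₃.isCoboundary₃_of_contraction [CharZero K] {F : ℤ → ℤ → ℤ → K}
    (hF : IsCocycle₃ F) (hm : ∀ i n, -1 ≤ i → F (-1) i n = 0) : IsCoboundary₃ F := by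
  obtain ⟨φ, hφ, h0, h1, h23⟩ := hF.exists_second_eq
  refine .of_sub hφ ?_
  have hG := hF.sub hφ
  exact hG.isCoboundary₃_of_nonneg_nonneg (hG.eq_zero_of_nonneg_nonneg
    (fun i n hi => by rw [hm i n hi, h0 i n hi, sub_zero])
    (fun j hj => sub_eq_zero.mpr (h1 j hj)) (sub_eq_zero.mpr h23))

/-- Every alternating `3`-cocycle of degree zero of the Witt algebra is a coboundary. -/
theorem IsCocycle₃.isCoboundary₃ [CharZero K] {F : ℤ → ℤ → ℤ → K} (hF : IsCocycle₃ F) :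
    IsCoboundary₃ F := by
  obtain ⟨φ, hφ, h⟩ := hF.exists_contraction_eq
  exact .of_sub hφ ((hF.sub hφ).isCoboundary₃_of_contraction
    fun i n hi => sub_eq_zero.mpr (h i n hi))

end WittCochain

/-! ### Explicit coboundaries in low degrees -/

namespace ChevalleyEilenberg

variable {K L M : Type*} [Field K] [LieRing L] [LieAlgebra K L]
  [AddCommGroup M] [Module K M] [LieRingModule L M]

section update

variable {α : Type*} (a b c x : α)

theorem update_one : Function.update ![a] 0 x = ![x] := by
  ext l; fin_cases l; rfl

theorem update_two : Function.update ![a, b] 0 x = ![x, b] ∧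
    Function.update ![a, b] 1 x = ![a, x] := by
  constructor <;> (ext l; fin_cases l <;> rfl)

theorem update_three : Function.update ![a, b, c] 0 x = ![x, b, c] ∧
    Function.update ![a, b, c] 1 x = ![a, x, c] ∧ Function.update ![a, b, c] 2 x = ![a, b, x] := by
  refine ⟨?_, ?_, ?_⟩ <;> (ext l; fin_cases l <;> rfl)

end update

theorem lieDer_one (x : L) (ψ : Cochain K L M 1) (a : L) :
    lieDer x ψ ![a] = ⁅x, ψ ![a]⁆ - ψ ![⁅x, a⁆] := by
  simp [lieDer, update_one]

theorem lieDer_two (x : L) (ψ : Cochain K L M 2) (a b : L) :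
    lieDer x ψ ![a, b] = ⁅x, ψ ![a, b]⁆ - ψ ![⁅x, a⁆, b] - ψ ![a, ⁅x, b⁆] := by
  rw [lieDer, Fin.sum_univ_two, (update_two a b _).1, (update_two a b _).2, ← sub_sub]
  rfl

theorem lieDer_three (x : L) (ψ : Cochain K L M 3) (a b c : L) :
    lieDer x ψ ![a, b, c] =
      ⁅x, ψ ![a, b, c]⁆ - ψ ![⁅x, a⁆, b, c] - ψ ![a, ⁅x, b⁆, c] - ψ ![a, b, ⁅x, c⁆] := by
  rw [lieDer, Fin.sum_univ_three, (update_three a b c _).1, (update_three a b c _).2.1,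
    (update_three a b c _).2.2, ← sub_sub, ← sub_sub]
  rfl

variable [CharZero K] [LieModule K L M]

theorem coboundary_one_apply (ψ : Cochain K L M 1) (a b : L) :
    coboundary 1 ψ ![a, b] = -(⁅a, ψ ![b]⁆ - ψ ![⁅a, b⁆]) + ⁅b, ψ ![a]⁆ := by
  refine (coboundary_cons ψ a ![b]).trans ?_
  rw [lieDer_one, show coboundary 0 (ψ.curryLeft a) ![b] = _ from coboundary_cons_zero _ b ![],
    sub_neg_eq_add]
  rfl

theorem coboundary_two_apply (ψ : Cochain K L M 2) (a b c : L) :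
    coboundary 2 ψ ![a, b, c] =
      -(⁅a, ψ ![b, c]⁆ - ψ ![⁅a, b⁆, c] - ψ ![b, ⁅a, c⁆])
      + (⁅b, ψ ![a, c]⁆ - ψ ![a, ⁅b, c⁆]) - ⁅c, ψ ![a, b]⁆ := by
  refine (coboundary_cons ψ a ![b, c]).trans ?_
  rw [lieDer_two, coboundary_one_apply]
  simp only [show ∀ x, ψ.curryLeft a ![x] = ψ ![a, x] from fun _ => rfl]
  abel

theorem coboundary_three_apply (ψ : Cochain K L M 3) (a b c e : L) :
    coboundary 3 ψ ![a, b, c, e] =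
      -(⁅a, ψ ![b, c, e]⁆ - ψ ![⁅a, b⁆, c, e] - ψ ![b, ⁅a, c⁆, e] - ψ ![b, c, ⁅a, e⁆])
      + (⁅b, ψ ![a, c, e]⁆ - ψ ![a, ⁅b, c⁆, e] - ψ ![a, c, ⁅b, e⁆])
      - (⁅c, ψ ![a, b, e]⁆ - ψ ![a, b, ⁅c, e⁆]) + ⁅e, ψ ![a, b, c]⁆ := by
  refine (coboundary_cons ψ a ![b, c, e]).trans ?_
  rw [lieDer_three, coboundary_two_apply]
  simp only [show ∀ x y, ψ.curryLeft a ![x, y] = ψ ![a, x, y] from fun _ _ => rfl]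
  abel

end ChevalleyEilenberg

/-! ### From cochains to coefficients and back -/

namespace Witt

open ChevalleyEilenberg WittCochain

variable {K : Type*} [Field K]

theorem repr_lie_e (i n : ℤ) (x : Witt K) :
    (basis K).repr ⁅(e i : Witt K), x⁆ n = ((n - i : ℤ) - (i : K)) * (basis K).repr x (n - i) := by
  have h : (basis K).coord n ∘ₗ (LieModule.toEnd K (Witt K) (Witt K) (e i)) =
      ((n - i : ℤ) - (i : K)) • (basis K).coord (n - i) := by
    refine (basis K).ext fun m => ?_
    change (basis K).repr ⁅(e i : Witt K), e m⁆ n =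
      ((n - i : ℤ) - (i : K)) * (basis K).repr (e m) (n - i)
    rw [lie_e, e, e, map_smul, Finsupp.smul_apply, (basis K).repr_self, (basis K).repr_self]
    by_cases hm : m = n - i
    · subst hm; simp
    · rw [Finsupp.single_eq_of_ne (by omega), Finsupp.single_eq_of_ne (by omega)]; simp
  exact LinearMap.congr_fun h x

/-- The coefficients of the component of degree `d` of a `2`-cochain. -/
noncomputable def coeff₂ (φ : Cochain K (Witt K) (Witt K) 2) (d i j : ℤ) : K :=
  (basis K).repr (φ ![e i, e j]) (i + j + d)

/-- The coefficients of the component of degree `d` of a `3`-cochain. -/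
noncomputable def coeff₃ (ψ : Cochain K (Witt K) (Witt K) 3) (d i j k : ℤ) : K :=
  (basis K).repr (ψ ![e i, e j, e k]) (i + j + k + d)

theorem coeff₃_alt (ψ : Cochain K (Witt K) (Witt K) 3) (d : ℤ) : Alt₃ (coeff₃ ψ d) where
  swap₁₂ i j k := by
    have h := ψ.map_swap ![e i, e j, e k] (i := 0) (j := 1) (by decide)
    have h2 : (![e i, e j, e k] : Fin 3 → Witt K) ∘ Equiv.swap 0 1 = ![e j, e i, e k] := by
      ext l; fin_cases l <;> rfl
    rw [h2] at h
    rw [coeff₃, coeff₃, h, add_comm j i, map_neg, Finsupp.neg_apply]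
  swap₂₃ i j k := by
    have h := ψ.map_swap ![e i, e j, e k] (i := 1) (j := 2) (by decide)
    have h2 : (![e i, e j, e k] : Fin 3 → Witt K) ∘ Equiv.swap 1 2 = ![e i, e k, e j] := by
      ext l; fin_cases l <;> rfl
    rw [h2] at h
    rw [coeff₃, coeff₃, h, add_right_comm i k j, map_neg, Finsupp.neg_apply]

theorem map_smul_two (φ : Cochain K (Witt K) (Witt K) 2) (c : K) (x y : Witt K) :
    φ ![c • x, y] = c • φ ![x, y] ∧ φ ![x, c • y] = c • φ ![x, y] :=
  ⟨by have h := φ.map_update_smul ![x, y] 0 c x; simpa only [update_two] using h,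
    by have h := φ.map_update_smul ![x, y] 1 c y; simpa only [update_two] using h⟩

theorem map_smul_three (φ : Cochain K (Witt K) (Witt K) 3) (c : K) (x y z : Witt K) :
    φ ![c • x, y, z] = c • φ ![x, y, z] ∧ φ ![x, c • y, z] = c • φ ![x, y, z] ∧
      φ ![x, y, c • z] = c • φ ![x, y, z] :=
  ⟨by have h := φ.map_update_smul ![x, y, z] 0 c x; simpa only [update_three] using h,
    by have h := φ.map_update_smul ![x, y, z] 1 c y; simpa only [update_three] using h,
    by have h := φ.map_update_smul ![x, y, z] 2 c z; simpa only [update_three] using h⟩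

theorem coeff₃_coboundary [CharZero K] (φ : Cochain K (Witt K) (Witt K) 2) (d : ℤ) :
    coeff₃ (coboundary 2 φ) d = cob₂ d (coeff₂ φ d) := by
  funext a b c
  simp only [coeff₃, coboundary_two_apply, lie_e, (map_smul_two φ _ _ _).1,
    (map_smul_two φ _ _ _).2, map_add, map_sub, map_neg, map_smul, Finsupp.add_apply,
    Finsupp.sub_apply, Finsupp.neg_apply, Finsupp.smul_apply, repr_lie_e, smul_eq_mul, cob₂, coeff₂]
  rw [show a + b + c + d - a = b + c + d by ring, show a + b + c + d - b = a + c + d by ring,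
    show a + b + c + d - c = a + b + d by ring, show b + (a + c) + d = a + b + c + d by ring,
    show a + (b + c) + d = a + b + c + d by ring]
  push_cast
  ring

theorem cob₃_coeff₃ [CharZero K] (ψ : Cochain K (Witt K) (Witt K) 3) (d a b c f : ℤ) :
    cob₃ d (coeff₃ ψ d) a b c f =
      (basis K).repr (coboundary 3 ψ ![e a, e b, e c, e f]) (a + b + c + f + d) := by
  simp only [coeff₃, coboundary_three_apply, lie_e, (map_smul_three ψ _ _ _ _).1,
    (map_smul_three ψ _ _ _ _).2.1, (map_smul_three ψ _ _ _ _).2.2, map_add, map_sub, map_neg,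
    map_smul, Finsupp.add_apply,
    Finsupp.sub_apply, Finsupp.neg_apply, Finsupp.smul_apply, repr_lie_e, smul_eq_mul, cob₃]
  rw [show a + b + c + f + d - a = b + c + f + d by ring,
    show a + b + c + f + d - b = a + c + f + d by ring,
    show a + b + c + f + d - c = a + b + f + d by ring,
    show a + b + c + f + d - f = a + b + c + d by ring,
    show b + (a + c) + f + d = a + b + c + f + d by ring,
    show a + (b + c) + f + d = a + b + c + f + d by ring,
    show b + c + (a + f) + d = a + b + c + f + d by ring,
    show a + c + (b + f) + d = a + b + c + f + d by ring,
    show a + b + (c + f) + d = a + b + c + f + d by ring]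
  push_cast
  ring

/-- An antisymmetric family of values at pairs of basis vectors extends to a `2`-cochain. -/
theorem exists_cochain₂ [CharZero K] (v : ℤ → ℤ → Witt K) (hv : ∀ i j, v j i = -v i j) :
    ∃ φ : Cochain K (Witt K) (Witt K) 2, ∀ i j, φ ![e i, e j] = v i j := by
  let B : Witt K →ₗ[K] Witt K →ₗ[K] Witt K :=
    (basis K).constr K fun i => (basis K).constr K fun j => v i j
  have hB : ∀ i j, B (e i) (e j) = v i j := fun i j => by
    simp [B, e, Module.Basis.constr_basis]
  have hskew : B = -B.flip := by
    refine (basis K).ext fun i => (basis K).ext fun j => ?_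
    change B (e i) (e j) = -B (e j) (e i)
    rw [hB, hB, hv i j, neg_neg]
  have hself : ∀ x, B x x = 0 := fun x => by
    have h : B x x = -B x x := LinearMap.congr_fun₂ hskew x x
    have h2 : (2 : K) • B x x = 0 := by rw [two_smul]; nth_rewrite 1 [h]; exact neg_add_cancel _
    exact (smul_eq_zero.mp h2).resolve_left two_ne_zero
  refine ⟨{ toFun := fun x => B (x 0) (x 1), map_update_add' := ?_, map_update_smul' := ?_,
            map_eq_zero_of_eq' := ?_ }, fun i j => hB i j⟩
  · intro _ x i a b
    fin_cases i <;> simp [Function.update]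
  · intro _ x i c a
    fin_cases i <;> simp [Function.update]
  · intro x i j h hij
    have h01 : x 0 = x 1 := by
      fin_cases i <;> fin_cases j
      exacts [absurd rfl hij, h, h.symm, absurd rfl hij]
    change B (x 0) (x 1) = 0
    rw [h01, hself]

/-- The primitives of all degrees are prescribed at once on pairs of basis vectors; equality of
coboundaries is then checked degree by degree. -/
theorem cocycle₃_mem_range [CharZero K] (ψ : Cochain K (Witt K) (Witt K) 3)
    (hψ : coboundary 3 ψ = 0) : ∃ φ, coboundary 2 φ = ψ := by
  have hc : ∀ d a b c f, cob₃ d (coeff₃ ψ d) a b c f = 0 := fun d a b c f => by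
    rw [cob₃_coeff₃, hψ]; simp
  obtain ⟨φ₀, hφ₀, h₀⟩ := (show IsCocycle₃ (coeff₃ ψ 0) from
    ⟨coeff₃_alt ψ 0, hc 0⟩).isCoboundary₃
  let y : ℤ → ℤ → ℤ →₀ K := fun i j => (basis K).repr (ψ ![e 0, e i, e j])
  -- This collects the primitives `-F 0 i j / d` over all `d = n - (i + j)`; its support lies in
  -- that of `ψ ![e 0, e i, e j]`. At `d = 0` division by zero returns `0`, which leaves the place
  -- for `φ₀`.
  let z : ℤ → ℤ → ℤ →₀ K := fun i j =>
    Finsupp.onFinset (y i j).support (fun n => -(y i j n / ((n - (i + j) : ℤ) : K)))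
      (fun n hn => by rw [Finsupp.mem_support_iff]; rintro h; simp [h] at hn)
  let v : ℤ → ℤ → Witt K := fun i j => (basis K).repr.symm (z i j) + φ₀ i j • e (i + j)
  have hy : ∀ i j, y j i = -y i j := fun i j => by
    ext n
    have := (coeff₃_alt ψ (n - (i + j))).swap₂₃ 0 i j
    simp only [coeff₃] at this
    rwa [show 0 + j + i + (n - (i + j)) = n by ring, show 0 + i + j + (n - (i + j)) = n by ring]
      at this
  have hv : ∀ i j, v j i = -v i j := fun i j => by
    have hz : z j i = -z i j := by
      ext n
      simp only [z, Finsupp.onFinset_apply, Finsupp.neg_apply, hy i j, add_comm j i]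
      ring
    simp only [v]
    rw [hz, hφ₀ i j, map_neg, add_comm j i, neg_smul, neg_add]
  obtain ⟨φ, hφ⟩ := exists_cochain₂ v hv
  have hcoeff : ∀ d, coeff₃ (coboundary 2 φ) d = coeff₃ ψ d := by
    intro d
    rw [coeff₃_coboundary]
    have h1 : ∀ i j, coeff₂ φ d i j = -(coeff₃ ψ d 0 i j / d) + if d = 0 then φ₀ i j else 0 := by
      intro i j
      rw [coeff₂, hφ, coeff₃]
      simp only [v, map_add, LinearEquiv.apply_symm_apply, map_smul, Finsupp.add_apply,
        Finsupp.smul_apply, e, (basis K).repr_self, z, y, Finsupp.onFinset_apply, zero_add,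
        add_sub_cancel_left]
      congr 1
      by_cases hd : d = 0
      · subst hd; simp
      · rw [Finsupp.single_eq_of_ne (by omega), if_neg hd, smul_zero]
    by_cases hd : d = 0
    · subst hd
      rw [← h₀]
      congr 1
      funext i j
      rw [h1]
      simp
    · rw [← cob₂_eq_of_ne_zero hd (hc d)]
      congr 1
      funext i j
      rw [h1, if_neg hd, add_zero]
  refine ⟨φ, (basis K).ext_alternating fun w _ => ?_⟩
  have hw : (fun i => basis K (w i)) = ![e (w 0), e (w 1), e (w 2)] := by
    ext l; fin_cases l <;> rfl
  rw [hw]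
  refine (basis K).repr.injective (Finsupp.ext fun n => ?_)
  have := congr_fun (congr_fun (congr_fun (hcoeff (n - (w 0 + w 1 + w 2))) (w 0)) (w 1)) (w 2)
  simpa only [coeff₃, add_sub_cancel] using this

end Witt

theorem theorem4p1 (K : Type*) [Field K] [CharZero K] :
    Subsingleton (ChevalleyEilenberg.Cohomology K (Witt K) (Witt K) 3) := by
  refine Submodule.Quotient.subsingleton_iff.mpr (Submodule.comap_subtype_eq_top.mpr ?_)
  exact fun ψ hψ => Witt.cocycle₃_mem_range ψ hψ
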